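/- Let $k$ be an algebraically closed field of characteristic zero and let $H$ be a semisimple Hopf algebra over $k$. Let $\mathrm{cd}(H) = \{\dim_k V : V \text{ a simple left } H\text{-module}\}$ be the set of its irreducible degrees, and let $G(H) = \{g \in H : \varepsilon(g) = 1,\ \Delta(g) = g \otimes g\}$ be the group of grouplike elements of $H$. If $\mathrm{cd}(H) \subseteq \{1, 2\}$, then $G(H)$ is solvable. -/

import Mathlib

/-- The set `cd(H)` of irreducible degrees of an algebra `H` over a field `k`: the dimensions over
`k` of the simple left `H`-modules `V`, where the `k`-structure of `V` is the one induced by that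
of `H`. Every simple `H`-module is isomorphic to a quotient of `H`, so modules in the universe of
`H` represent all isomorphism classes. -/
def irreducibleDegrees.{u, v} (k : Type u) (H : Type v) [Field k] [Ring H] [Algebra k H] :
    Set ℕ :=
  {d | ∃ (V : Type v) (_ : AddCommGroup V) (_ : Module k V) (_ : Module H V)
    (_ : IsScalarTower k H V), IsSimpleModule H V ∧ Module.finrank k V = d}

open scoped MonoidAlgebra

open Module

section LowDimension

variable {k V : Type*} [Field k] [AddCommGroup V] [Module k V]

/-! Grouplikes are linearly independent, so `k[G(H)]` embeds in `H`, and every simple left ideal of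
`k[P]`, for `P ≤ G(H)`, embeds in a simple `H`-module, hence has dimension 1 or 2. It remains to see
that a perfect such `P` is trivial. All determinants on `P` are 1, so `|P| · 1 + 2 ∑ g² - 3 ∑ g` has
trace zero on each simple left ideal (`card_mul_finrank_add_sum_char_sq`), hence on `k[P]`. There
its trace is `|P| (|P| + 2t - 3)` with `t = #{g | g² = 1} ≥ 1`, so `|P| = 1`. -/

theorem LinearMap.trace_eq_det_of_finrank_eq_one (h : finrank k V = 1) (f : V →ₗ[k] V) :
    LinearMap.trace k V f = LinearMap.det f := by
  have : FiniteDimensional k V := .of_finrank_eq_succ h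
  let b := finBasisOfFinrankEq k V h
  rw [LinearMap.trace_eq_matrix_trace k b, ← LinearMap.det_toMatrix b,
    Matrix.det_fin_one, Matrix.trace_fin_one]

/-- With determinant 1, the inverse is the adjugate, which in dimension 2 has the same trace. This
turns `∑ χ(g²)` into the norm of `χ`. -/
theorem LinearMap.trace_mul_self_of_finrank_eq_two (h : finrank k V = 2) {f f' : V →ₗ[k] V}
    (hf : f * f' = 1) (hdet : LinearMap.det f = 1) :
    LinearMap.trace k V (f * f) = LinearMap.trace k V f * LinearMap.trace k V f' - 2 := by
  have : FiniteDimensional k V := .of_finrank_eq_succ h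
  let b := finBasisOfFinrankEq k V h
  set M := LinearMap.toMatrix b b f with hM
  set M' := LinearMap.toMatrix b b f' with hM'
  have hdetM : M.det = 1 := by rw [hM, LinearMap.det_toMatrix, hdet]
  have hMM' : M * M' = 1 := by
    rw [hM, hM', ← LinearMap.toMatrix_mul, hf, LinearMap.toMatrix_one]
  have hadj : M' = M.adjugate := by
    rw [← one_mul M', ← one_smul k (1 : Matrix _ _ k), ← hdetM, ← Matrix.adjugate_mul, mul_assoc,
      hMM', mul_one]
  rw [LinearMap.trace_eq_matrix_trace k b, LinearMap.trace_eq_matrix_trace k b f,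
    LinearMap.trace_eq_matrix_trace k b f', LinearMap.toMatrix_mul, ← hM, ← hM', hadj,
    Matrix.adjugate_fin_two]
  rw [Matrix.det_fin_two] at hdetM
  simp only [Matrix.trace_fin_two, Matrix.mul_apply, Fin.sum_univ_two, Matrix.of_apply,
    Matrix.cons_val', Matrix.cons_val_zero, Matrix.cons_val_one, Matrix.cons_val_fin_one]
  linear_combination (-2) * hdetM

end LowDimension

theorem MonoidHom.eq_one_of_commutator_eq_top {G A : Type*} [Group G] [CommGroup A]
    (hG : commutator G = ⊤) (f : G →* A) : f = 1 := by
  rw [← MonoidHom.ker_eq_top_iff, eq_top_iff, ← hG]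
  exact Abelianization.commutator_subset_ker f

namespace Representation

variable {k G V : Type*} [Field k] [Group G] [AddCommGroup V] [Module k V]

theorem det_eq_one_of_commutator_eq_top (hG : commutator G = ⊤) (ρ : Representation k G V) (g : G) :
    LinearMap.det (ρ g) = 1 := by
  have := MonoidHom.eq_one_of_commutator_eq_top hG
    ((LinearMap.det : (V →ₗ[k] V) →* k).comp ρ).toHomUnits
  simpa using congrArg Units.val (DFunLike.congr_fun this g)

theorem invariants_eq_bot_of_isIrreducible (ρ : Representation k G V) [IsIrreducible ρ]
    (h : 1 < finrank k V) : ρ.invariants = ⊥ := by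
  rw [eq_bot_iff]
  intro v hv
  let σ : Subrepresentation ρ := ⟨k ∙ v, fun g w hw ↦ by
    obtain ⟨c, rfl⟩ := Submodule.mem_span_singleton.mp hw
    rw [map_smul, hv g]
    exact hw⟩
  rcases eq_bot_or_eq_top σ with hσ | hσ
  · have h0 : k ∙ v = ⊥ := congrArg Subrepresentation.toSubmodule hσ
    simpa using h0
  · have h1 : k ∙ v = ⊤ := congrArg Subrepresentation.toSubmodule hσ
    have hle := finrank_span_le_card (R := k) {v}
    rw [h1, finrank_top, Set.toFinset_singleton, Finset.card_singleton] at hle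
    omega

/-- For a perfect group, an irreducible representation of dimension `1` is trivial and one of
dimension `2` is self-dual with Frobenius–Schur indicator `-1`. Both cases are captured by one
linear relation between the dimension and the sums of `χ (g ^ 2)` and of `χ g`. -/
theorem card_mul_finrank_add_sum_char_sq [CharZero k] [IsAlgClosed k] [Fintype G]
    (hG : commutator G = ⊤) (ρ : Representation k G V) [IsIrreducible ρ]
    (h : finrank k V ∈ ({1, 2} : Set ℕ)) :
    (Nat.card G : k) * ρ.character 1 + 2 * ∑ g, ρ.character (g * g) - 3 * ∑ g, ρ.character g
      = 0 := by
  have hcard : (Nat.card G : k) ≠ 0 := Nat.cast_ne_zero.mpr Nat.card_pos.ne'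
  have : Invertible (Nat.card G : k) := invertibleOfNonzero hcard
  rcases h with h | h
  · have hχ (g : G) : ρ.character g = 1 := by
      rw [character, LinearMap.trace_eq_det_of_finrank_eq_one h,
        ρ.det_eq_one_of_commutator_eq_top hG]
    simp only [hχ, Finset.sum_const, Finset.card_univ, nsmul_eq_mul, ← Nat.card_eq_fintype_card]
    ring
  · have h : finrank k V = 2 := h
    have : FiniteDimensional k V := .of_finrank_eq_succ h
    have hsq (g : G) : ρ.character (g * g) = ρ.character g * ρ.character g⁻¹ - 2 := by
      rw [character, map_mul]
      exact LinearMap.trace_mul_self_of_finrank_eq_two h (by simp [← map_mul])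
        (ρ.det_eq_one_of_commutator_eq_top hG g)
    have horth := card_inv_mul_sum_char_mul_char_eq_finrank ρ ρ
    rw [IsIrreducible.finrank_intertwiningMap_self, Nat.cast_one, inv_mul_eq_one₀ hcard] at horth
    have hinv := card_inv_mul_sum_char_eq_finrank ρ
    rw [invariants_eq_bot_of_isIrreducible ρ (by omega), finrank_bot, Nat.cast_zero,
      mul_eq_zero, or_iff_right (inv_ne_zero hcard)] at hinv
    simp only [hsq, Finset.sum_sub_distrib, ← horth, hinv, char_one, h, Finset.sum_const,
      Finset.card_univ, nsmul_eq_mul, ← Nat.card_eq_fintype_card]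
    push_cast
    ring

theorem isIrreducible_ofModule' (M : Type*) [AddCommGroup M] [Module k M] [Module k[G] M]
    [IsScalarTower k k[G] M] [IsSimpleModule k[G] M] :
    IsIrreducible (ofModule' (k := k) (G := G) M) := by
  rw [irreducible_iff_isSimpleModule_asModule]
  have hsmul (r : k[G]) (m : (ofModule' (k := k) (G := G) M).asModule) :
      (ofModule' (k := k) (G := G) M).asModuleEquiv (r • m) =
        r • (ofModule' (k := k) (G := G) M).asModuleEquiv m := by
    rw [asModuleEquiv_map_smul]
    exact DFunLike.congr_fun (DFunLike.congr_fun
      ((MonoidAlgebra.lift k (M →ₗ[k] M) G).apply_symm_apply (Algebra.lsmul k k M)) r) _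
  exact IsSimpleModule.congr
    { (ofModule' (k := k) (G := G) M).asModuleEquiv.toAddEquiv with map_smul' := hsmul }

end Representation

/-- The trace of an element of an algebra on a module is determined by its traces on simple
submodules. -/
theorem LinearMap.trace_lsmul_eq_zero_of_isSimpleModule {k A M : Type*} [Field k] [Ring A]
    [Algebra k A] [AddCommGroup M] [Module k M] [Module A M] [IsScalarTower k A M]
    [FiniteDimensional k M] [IsSemisimpleModule A M] [Module.Finite A M] (a : A)
    (h : ∀ S : Submodule A M, IsSimpleModule A S → LinearMap.trace k S (Algebra.lsmul k k S a) = 0) :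
    LinearMap.trace k M (Algebra.lsmul k k M a) = 0 := by
  classical
  obtain ⟨n, S, e, hS⟩ := IsSemisimpleModule.exists_linearEquiv_fin_dfinsupp A M
  let ι (i : Fin n) : S i →ₗ[k] M :=
    (e.symm.toLinearMap ∘ₗ DFinsupp.lsingle (R := A) (M := fun i ↦ S i) i).restrictScalars k
  let π (i : Fin n) : M →ₗ[k] S i :=
    (DFinsupp.lapply (R := A) (M := fun i ↦ S i) i ∘ₗ e.toLinearMap).restrictScalars k
  have hfin (i : Fin n) : FiniteDimensional k (S i) :=
    inferInstanceAs (FiniteDimensional k ((S i).restrictScalars k))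
  have hπι (i : Fin n) : π i ∘ₗ ι i = LinearMap.id := by
    ext x
    simp [π, ι]
  have hsum : Algebra.lsmul k k M a = ∑ i, ι i ∘ₗ (Algebra.lsmul k k (S i) a ∘ₗ π i) := by
    ext x
    apply e.injective
    simp only [LinearMap.sum_apply, map_sum]
    ext i
    simp [π, ι, DFinsupp.single_apply]
  rw [hsum, map_sum]
  refine Finset.sum_eq_zero fun i _ ↦ ?_
  rw [LinearMap.trace_comp_comm', LinearMap.comp_assoc, hπι, LinearMap.comp_id]
  exact h _ (hS i)

open Classical in
theorem MonoidAlgebra.trace_lsmul_single {k G : Type*} [Field k] [Group G] [Fintype G] (g : G) :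
    LinearMap.trace k k[G] (Algebra.lsmul k k k[G] (MonoidAlgebra.single g (1 : k))) =
      if g = 1 then (Nat.card G : k) else 0 := by
  rw [LinearMap.trace_eq_matrix_trace k (MonoidAlgebra.basis G k), Matrix.trace]
  have hdiag (x : G) : (LinearMap.toMatrix (MonoidAlgebra.basis G k) (MonoidAlgebra.basis G k)
      (Algebra.lsmul k k k[G] (MonoidAlgebra.single g (1 : k)))).diag x =
        if g = 1 then 1 else 0 := by
    simp [LinearMap.toMatrix_apply, MonoidAlgebra.basis, Finsupp.single_apply]
  rw [Finset.sum_congr rfl fun x _ ↦ hdiag x, Finset.sum_const, Finset.card_univ,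
    ← Nat.card_eq_fintype_card]
  simp

/-- A perfect finite group all of whose irreducible representations have dimension at most `2` is
trivial. -/
theorem subsingleton_of_commutator_eq_top_of_finrank_le_two {k G : Type*} [Field k] [CharZero k]
    [IsAlgClosed k] [Group G] [Finite G] (hG : commutator G = ⊤)
    (h : ∀ S : Submodule k[G] k[G], IsSimpleModule k[G] S →
      finrank k S ∈ ({1, 2} : Set ℕ)) : Subsingleton G := by
  classical
  have := Fintype.ofFinite G
  have hcard : (Nat.card G : k) ≠ 0 := Nat.cast_ne_zero.mpr Nat.card_pos.ne'
  have : NeZero (Nat.card G : k) := ⟨hcard⟩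
  let δ (g : G) : k[G] := MonoidAlgebra.single g 1
  have htrace := LinearMap.trace_lsmul_eq_zero_of_isSimpleModule (k := k) (M := k[G])
    ((Nat.card G : k) • δ 1 + (2 : k) • ∑ g, δ (g * g) - (3 : k) • ∑ g, δ g) fun S hS ↦ by
      have := Representation.isIrreducible_ofModule' (k := k) (G := G) S
      have := Representation.card_mul_finrank_add_sum_char_sq hG
        (Representation.ofModule' (k := k) (G := G) S) (h S hS)
      simp only [map_sub, map_add, map_smul, map_sum, smul_eq_mul]
      exact this
  simp only [map_sub, map_add, map_smul, map_sum, smul_eq_mul, δ,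
    MonoidAlgebra.trace_lsmul_single, Finset.sum_ite, Finset.sum_const, nsmul_eq_mul,
    if_true] at htrace
  have hone : (Finset.univ.filter fun g : G ↦ g = 1).card = 1 :=
    Finset.card_eq_one.mpr ⟨1, by ext; simp⟩
  rw [hone] at htrace
  have hpos : 0 < (Finset.univ.filter fun g : G ↦ g * g = 1).card :=
    Finset.card_pos.mpr ⟨1, by simp⟩
  have hk : ((Nat.card G + 2 * (Finset.univ.filter fun g : G ↦ g * g = 1).card : ℕ) : k) =
      (3 : ℕ) := by
    push_cast
    apply mul_left_cancel₀ hcard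
    linear_combination htrace
  -- Now `|G| + 2t = 3` in `ℕ` with `t ≥ 1`.
  have hnat := Nat.cast_injective hk
  exact (Nat.card_eq_one_iff_unique.mp (by have := Nat.card_pos (α := G); omega)).1

section IrreducibleDegrees

universe u v

variable {k : Type u} {H : Type v} [Field k] [Ring H] [Algebra k H]

theorem finrank_quotient_mem_irreducibleDegrees (M : Submodule H H) (hM : IsCoatom M) :
    finrank k (H ⧸ M) ∈ irreducibleDegrees k H :=
  ⟨H ⧸ M, inferInstance, inferInstance, inferInstance, inferInstance,
    isSimpleModule_iff_isCoatom.mpr hM, rfl⟩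

/-- `finrank` is 0 on infinite-dimensional spaces, so excluding degree 0 makes all simple modules
finite-dimensional, and `H` is a finite sum of them. -/
theorem finiteDimensional_of_irreducibleDegrees [IsSemisimpleRing H]
    (hcd : 0 ∉ irreducibleDegrees k H) : FiniteDimensional k H := by
  obtain ⟨n, S, e, hS⟩ := IsSemisimpleModule.exists_linearEquiv_fin_dfinsupp H H
  have (i : Fin n) : FiniteDimensional k (S i) := by
    refine FiniteDimensional.of_finrank_pos (Nat.pos_of_ne_zero fun h0 ↦ hcd ?_)
    exact ⟨S i, inferInstance, inferInstance, inferInstance, inferInstance, hS i, h0⟩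
  exact Module.Finite.equiv (e.restrictScalars k).symm

/-- A simple left ideal of an algebra embedded in a semisimple algebra `H` embeds in a simple
`H`-module. -/
theorem exists_finrank_le_irreducibleDegree [IsSemisimpleRing H]
    (hcd : 0 ∉ irreducibleDegrees k H) {A : Type*} [Ring A] [Algebra k A] (f : A →ₐ[k] H)
    (hf : Function.Injective f) (S : Submodule A A) [IsSimpleModule A S] :
    ∃ d ∈ irreducibleDegrees k H, 0 < finrank k S ∧ finrank k S ≤ d := by
  have := IsSimpleModule.nontrivial A S
  obtain ⟨x, hx⟩ := exists_ne (0 : S)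
  -- The Jacobson radical of `H` vanishes, so some maximal left ideal misses `f x`.
  obtain ⟨M, hM, hxM⟩ : ∃ M : Submodule H H, IsCoatom M ∧ f x ∉ M := by
    by_contra! hall
    have hmem : f x ∈ Module.jacobson H H := by
      rw [Module.jacobson, Submodule.mem_sInf]
      exact hall
    rw [IsSemisimpleModule.jacobson_eq_bot, Submodule.mem_bot, map_eq_zero_iff f hf] at hmem
    exact hx (Subtype.ext hmem)
  have hd := finrank_quotient_mem_irreducibleDegrees (k := k) M hM
  have : FiniteDimensional k (H ⧸ M) :=
    FiniteDimensional.of_finrank_pos (Nat.pos_of_ne_zero fun h0 ↦ hcd (h0 ▸ hd))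
  let φ : S →ₗ[k] H ⧸ M :=
    (M.mkQ.restrictScalars k) ∘ₗ f.toLinearMap ∘ₗ (S.subtype.restrictScalars k)
  -- The kernel is `A`-stable and misses `x`, so it is zero by simplicity of `S`.
  let N : Submodule A S :=
    { LinearMap.ker φ with
      smul_mem' := fun a y hy ↦ by
        have hy : f y ∈ M := (Submodule.Quotient.mk_eq_zero M).mp hy
        refine (Submodule.Quotient.mk_eq_zero M).mpr ?_
        simpa using M.smul_mem (f a) hy }
  have hN : N = ⊥ := (eq_bot_or_eq_top N).resolve_right fun htop ↦
    hxM ((Submodule.Quotient.mk_eq_zero M).mp (htop ▸ Submodule.mem_top : x ∈ N))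
  have hφ : Function.Injective φ := by
    rw [← LinearMap.ker_eq_bot, eq_bot_iff]
    intro y hy
    have : y ∈ N := hy
    rwa [hN] at this
  have : FiniteDimensional k S := Module.Finite.of_injective φ hφ
  exact ⟨_, hd, finrank_pos, LinearMap.finrank_le_finrank_of_injective hφ⟩

end IrreducibleDegrees

/-- In a finite group, the derived series can only stall at a perfect subgroup. -/
theorem Group.isSolvable_of_forall_commutator_eq_top {G : Type*} [Group G] [Finite G]
    (h : ∀ P : Subgroup G, commutator P = ⊤ → Subsingleton P) : Group.IsSolvable G := by
  rw [Group.isSolvable_iff_commutator_lt]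
  intro P hP
  refine lt_of_le_of_ne (Subgroup.commutator_le_self P) fun heq ↦ hP ?_
  have := h P (by
    apply Subgroup.map_injective P.subtype_injective
    rw [Subgroup.map_subtype_commutator, heq, ← MonoidHom.range_eq_map, P.range_subtype])
  exact Subgroup.eq_bot_of_subsingleton P

namespace GroupLike

variable (k H : Type*) [Field k] [Ring H] [HopfAlgebra k H]

def valHom : GroupLike k H →* H where
  toFun := val
  map_one' := val_one
  map_mul' := val_mul

theorem lift_valHom_injective :
    Function.Injective (MonoidAlgebra.lift k H (GroupLike k H) (valHom k H)) := by
  intro x y hxy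
  simp only [MonoidAlgebra.lift_apply] at hxy
  exact MonoidAlgebra.coeff_injective (linearIndep_groupLikeVal (R := k) (A := H) hxy)

end GroupLike

theorem mainTheorem11 {k : Type*} [Field k] [IsAlgClosed k] [CharZero k]
    {H : Type*} [Ring H] [HopfAlgebra k H] [IsSemisimpleRing H]
    (hcd : irreducibleDegrees k H ⊆ {1, 2}) :
    Group.IsSolvable (GroupLike k H) := by
  have h0 : 0 ∉ irreducibleDegrees k H := fun h ↦ by simpa using hcd h
  have := finiteDimensional_of_irreducibleDegrees h0
  have : Finite (GroupLike k H) := (linearIndep_groupLikeVal (R := k) (A := H)).finite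
  refine Group.isSolvable_of_forall_commutator_eq_top fun P hP ↦
    subsingleton_of_commutator_eq_top_of_finrank_le_two (k := k) hP fun S hS ↦ ?_
  let j : k[P] →ₐ[k] H := (MonoidAlgebra.lift k H (GroupLike k H) (GroupLike.valHom k H)).comp
    (MonoidAlgebra.mapDomainAlgHom k k P.subtype)
  have hj : Function.Injective j := (GroupLike.lift_valHom_injective k H).comp
    (MonoidAlgebra.mapDomain_injective P.subtype_injective)
  obtain ⟨d, hd, hpos, hle⟩ := exists_finrank_le_irreducibleDegree h0 j hj S
  have hd2 : d ≤ 2 := by rcases hcd hd with rfl | rfl <;> norm_num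
  have : finrank k S = 1 ∨ finrank k S = 2 := by omega
  exact this
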